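/- Let $P$ be a finite partially ordered set with $n$ elements. For $k\ge 0$ let $c_k(P)$ be the maximal number of elements in a union of $k$ chains (totally ordered subsets) of $P$, put $\lambda_k=c_k(P)-c_{k-1}(P)$ for $k\ge 1$, and let $\lambda(P)=(\lambda_1,\lambda_2,\dots)$. The incidence algebra $I(P)$ is the algebra of complex matrices $M$ with rows and columns indexed by $P$ such that $M_{ij}\ne 0$ implies $i\le j$ in $P$. A nilpotent element $M\in I(P)$ is called generic if its entries $M_{ij}$, for $i<j$ in $P$, are algebraically independent over $\mathbb{Q}$. The Jordan partition of an $n\times n$ complex matrix is the sequence $(n_1,n_2,\dots)$ of the sizes $n_1\ge n_2\ge\cdots$ of the blocks of its Jordan canonical form, continued by zeros. Theorem. If $M$ is a generic nilpotent element of $I(P)$, then the Jordan partition of $M$ is equal to $\lambda(P)$; that is, $n_k=\lambda_k$ for all $k\ge 1$. -/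

import Mathlib

/-- The possible numbers of elements in a union of `k` chains of the poset `P`
(the chains may overlap, coincide or be empty). -/
def chainUnionSizes (P : Type*) [PartialOrder P] (k : ℕ) : Set ℕ :=
  {m | ∃ C : Fin k → Set P, (∀ i, IsChain (· ≤ ·) (C i)) ∧ (⋃ i, C i).ncard = m}

/-- `maxChainUnion P k` is the number `c_k(P)`: the maximal number of elements in a union of
`k` chains of the finite poset `P`. -/
noncomputable def maxChainUnion (P : Type*) [PartialOrder P] (k : ℕ) : ℕ :=
  sSup (chainUnionSizes P k)

/-- For finite `P` the supremum defining `c_k(P)` is a genuine maximum. -/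
theorem maxChainUnion_isGreatest (P : Type*) [PartialOrder P] [Finite P] (k : ℕ) :
    IsGreatest (chainUnionSizes P k) (maxChainUnion P k) := by
  have hb : BddAbove (chainUnionSizes P k) := by
    refine ⟨Nat.card P, ?_⟩
    rintro m ⟨C, -, rfl⟩
    exact Set.ncard_le_card _
  have hne : (chainUnionSizes P k).Nonempty :=
    ⟨_, fun _ => ∅, fun _ => by simp [IsChain], rfl⟩
  exact ⟨Nat.sSup_mem hne hb, fun m hm => le_csSup hb hm⟩

/-- `c_k(P) ≤ c_{k+1}(P)`, so that the subtraction in `chainShape` is not truncated. -/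
theorem maxChainUnion_le_succ (P : Type*) [PartialOrder P] [Finite P] (k : ℕ) :
    maxChainUnion P k ≤ maxChainUnion P (k + 1) := by
  obtain ⟨C, hC, h⟩ := (maxChainUnion_isGreatest P k).1
  refine (maxChainUnion_isGreatest P (k + 1)).2
    ⟨Fin.cons ∅ C, fun i => ?_, ?_⟩
  · refine Fin.cases ?_ (fun j => ?_) i
    · simp [IsChain]
    · simpa using hC j
  · rw [← h]
    congr 1
    ext x
    simp

/-- The partition `λ(P)`, as a sequence of row lengths followed by zeros. Sequences are indexed
from `0`: the value at `k` is `λ_{k+1} = c_{k+1}(P) - c_k(P)`. -/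
noncomputable def chainShape (P : Type*) [PartialOrder P] (k : ℕ) : ℕ :=
  maxChainUnion P (k + 1) - maxChainUnion P k

/-- The incidence algebra `I(P)` of a finite poset `P`: all complex matrices `M`, with rows and
columns indexed by `P`, such that `M i j ≠ 0` implies `i ≤ j`. -/
def incidenceMatrixAlgebra (P : Type*) [PartialOrder P] [Fintype P] [DecidableEq P] :
    Subalgebra ℂ (Matrix P P ℂ) where
  carrier := {M | ∀ i j, M i j ≠ 0 → i ≤ j}
  mul_mem' := by
    intro A B hA hB i j h
    rw [Matrix.mul_apply] at h
    obtain ⟨l, -, hl⟩ := Finset.exists_ne_zero_of_sum_ne_zero h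
    exact (hA i l (left_ne_zero_of_mul hl)).trans (hB l j (right_ne_zero_of_mul hl))
  add_mem' := by
    intro A B hA hB i j h
    by_contra hij
    have h1 : A i j = 0 := by_contra fun h1 => hij (hA i j h1)
    have h2 : B i j = 0 := by_contra fun h2 => hij (hB i j h2)
    exact h (by simp [h1, h2])
  algebraMap_mem' := by
    intro r i j h
    by_contra hij
    have hne : i ≠ j := fun e => hij e.le
    exact h (by simp [Matrix.algebraMap_matrix_apply, hne])

/-- `M` is a generic nilpotent element of the incidence algebra `I(P)`: it is a nilpotent element
of `I(P)` whose entries `M i j`, `i < j` in `P`, are algebraically independent over `ℚ`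
(as a family indexed by the pairs `i < j`). -/
structure IsGenericNilpotent {P : Type*} [PartialOrder P] [Fintype P] [DecidableEq P]
    (M : Matrix P P ℂ) : Prop where
  mem : M ∈ incidenceMatrixAlgebra P
  nilpotent : IsNilpotent M
  generic : AlgebraicIndependent ℚ (fun p : {p : P × P // p.1 < p.2} => M p.1.1 p.1.2)

/-- The `m × m` Jordan block with eigenvalue `μ`: `μ` on the diagonal and `1` just above it. -/
def jordanBlock (μ : ℂ) (m : ℕ) : Matrix (Fin m) (Fin m) ℂ :=
  Matrix.of fun i j => if i = j then μ else if (i : ℕ) + 1 = (j : ℕ) then 1 else 0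

/-- `ν` is the Jordan partition of the square complex matrix `M`: `M` is similar to a block
diagonal matrix formed by Jordan blocks of positive sizes `n_1 ≥ n_2 ≥ ⋯ ≥ n_r`, and `ν` is the
sequence `n_1, n_2, …, n_r, 0, 0, …` (indexed from `0`). The bijection `e` only numbers the rows
and columns. -/
def IsJordanPartition {ι : Type*} [Fintype ι] [DecidableEq ι] (M : Matrix ι ι ℂ) (ν : ℕ → ℕ) :
    Prop :=
  ∃ (r : ℕ) (size : Fin r → ℕ) (eig : Fin r → ℂ) (e : (Σ i : Fin r, Fin (size i)) ≃ ι)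
    (S : (Matrix ι ι ℂ)ˣ),
    (∀ i, 0 < size i) ∧ Antitone size ∧
    M = S.val * Matrix.reindex e e
      (Matrix.blockDiagonal' fun i => jordanBlock (eig i) (size i)) * S⁻¹.val ∧
    ∀ k, ν k = if h : k < r then size ⟨k, h⟩ else 0

/-!
Let `X ^ d` be the largest power of `X` that divides all minors of `X - M` omitting at most `k`
rows and columns; it depends only on the conjugacy class of `M`. A nonzero term of such a minor is
given by an injective partial map `r i ↦ s i` of `P` with `r i ≤ s i`. Each fixed point contributes
a factor `X`, and the elements that are not fixed points are covered by at most `k` chains, so that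
`d ≥ |P| - c_k(P)` whenever `M` is strictly upper triangular. For generic `M` equality holds, since
`M` specializes to a nilpotent Jordan matrix whose blocks run along `k` chains with a maximal union.
The Jordan form of `M` is itself strictly upper triangular over a disjoint union `Q` of chains with
`n_1 ≥ n_2 ≥ ⋯` elements, and there equality holds as well. Therefore
`c_k(P) = c_k(Q) = n_1 + ⋯ + n_k`.
-/

open Matrix Polynomial

section Minors

variable {P Q R S κ : Type*} [Fintype P] [CommRing R] {a : R} {A : Matrix P P R} {k : ℕ}

/-- `a` divides all minors of the square matrix `A` that omit at most `k` rows and columns, that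
is, `a` divides a determinantal divisor of `A`. Rows and columns of a minor may be listed in any
order and with repetitions, the latter only adding minors that vanish. -/
def DvdCorankMinors (a : R) (A : Matrix P P R) (k : ℕ) : Prop :=
  ∀ ⦃m : ℕ⦄, Fintype.card P ≤ m + k → ∀ r s : Fin m → P, a ∣ (A.submatrix r s).det

namespace DvdCorankMinors

theorem dvd_det_submatrix [Fintype κ] [DecidableEq κ] (h : DvdCorankMinors a A k)
    (hκ : Fintype.card P ≤ Fintype.card κ + k) (r s : κ → P) : a ∣ (A.submatrix r s).det := by
  let e := (Fintype.equivFin κ).symm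
  have he := h hκ (r ∘ e) (s ∘ e)
  rwa [← submatrix_submatrix, det_submatrix_equiv_self] at he

theorem transpose (h : DvdCorankMinors a A k) : DvdCorankMinors a Aᵀ k := fun m hm r s => by
  rw [← transpose_submatrix, det_transpose]
  exact h hm s r

theorem mul_left (B : Matrix P P R) (h : DvdCorankMinors a A k) :
    DvdCorankMinors a (B * A) k := fun m hm r s => by
  classical
  have rows : ((B * A).submatrix r s).det =
      detRowAlternating fun i => ∑ p, B (r i) p • fun j => A p (s j) := by
    change detRowAlternating _ = _
    congr 1
    ext i j
    simp [mul_apply, Finset.sum_apply]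
  rw [rows, ← AlternatingMap.coe_multilinearMap, MultilinearMap.map_sum]
  refine Finset.dvd_sum fun g _ => ?_
  rw [MultilinearMap.map_smul_univ, smul_eq_mul]
  exact (h hm g s).mul_left _

theorem mul_right (B : Matrix P P R) (h : DvdCorankMinors a A k) :
    DvdCorankMinors a (A * B) k := by
  simpa only [transpose_mul, transpose_transpose] using (h.transpose.mul_left Bᵀ).transpose

theorem reindex [Fintype Q] (e : P ≃ Q) (h : DvdCorankMinors a A k) :
    DvdCorankMinors a (Matrix.reindex e e A) k := fun m hm r s => by
  rw [reindex_apply, submatrix_submatrix]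
  exact h ((Fintype.card_congr e).trans_le hm) _ _

theorem map [CommRing S] (f : R →+* S) (h : DvdCorankMinors a A k) :
    DvdCorankMinors (f a) (A.map f) k := fun m hm r s => by
  have hdet : ((A.map f).submatrix r s).det = f (A.submatrix r s).det := (f.map_det _).symm
  exact hdet ▸ map_dvd f (h hm r s)

theorem of_charmatrix_map [DecidableEq P] [CommRing S] {f : R →+* S} (hf : Function.Injective f)
    {d : ℕ} (h : DvdCorankMinors (X ^ d) (A.map f).charmatrix k) :
    DvdCorankMinors (X ^ d) A.charmatrix k := fun m hm r s => by
  have hdet : ((A.map f).charmatrix.submatrix r s).det =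
      (A.charmatrix.submatrix r s).det.map f := by
    rw [charmatrix_map]
    exact ((mapRingHom f).map_det _).symm
  have hdvd := h hm r s
  rw [hdet, X_pow_dvd_iff] at hdvd
  exact X_pow_dvd_iff.2 fun i hi =>
    (injective_iff_map_eq_zero f).1 hf _ ((coeff_map f i).symm.trans (hdvd i hi))

theorem charmatrix_map [DecidableEq P] [CommRing S] (f : R →+* S) {d : ℕ}
    (h : DvdCorankMinors (X ^ d) A.charmatrix k) :
    DvdCorankMinors (X ^ d) (A.map f).charmatrix k := by
  simpa only [Matrix.charmatrix_map, map_pow, coe_mapRingHom, map_X] using h.map (mapRingHom f)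

end DvdCorankMinors

theorem charmatrix_units_conj [DecidableEq P] (U : (Matrix P P R)ˣ) (A : Matrix P P R) :
    (U.val * A * U⁻¹.val).charmatrix =
      C.mapMatrix U.val * A.charmatrix * C.mapMatrix U⁻¹.val := by
  rw [charmatrix, charmatrix, mul_sub, sub_mul, ← map_mul, ← map_mul,
    ← (scalar_commute (X : R[X]) (fun _ => Commute.all _ _) _).eq, mul_assoc (scalar P X),
    ← map_mul, Units.mul_inv, map_one, mul_one]

theorem dvdCorankMinors_charmatrix_units_conj_iff [DecidableEq P] (U : (Matrix P P R)ˣ)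
    {f : R[X]} : DvdCorankMinors f (U.val * A * U⁻¹.val).charmatrix k ↔
      DvdCorankMinors f A.charmatrix k := by
  have conj (V : (Matrix P P R)ˣ) (B : Matrix P P R) (h : DvdCorankMinors f B.charmatrix k) :
      DvdCorankMinors f (V.val * B * V⁻¹.val).charmatrix k := by
    rw [charmatrix_units_conj]
    exact (h.mul_left _).mul_right _
  refine ⟨fun h => ?_, conj U A⟩
  simpa [mul_assoc] using conj U⁻¹ _ h

theorem dvdCorankMinors_charmatrix_reindex_iff [DecidableEq P] [Fintype Q] [DecidableEq Q]
    (e : P ≃ Q) {f : R[X]} :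
    DvdCorankMinors f (reindex e e A).charmatrix k ↔ DvdCorankMinors f A.charmatrix k := by
  rw [charmatrix_reindex]
  refine ⟨fun h => ?_, fun h => h.reindex e⟩
  simpa using h.reindex e.symm

end Minors

section ChainUnions

variable {P ι κ : Type*} [PartialOrder P] {k : ℕ}

theorem maxChainUnion_le_card [Fintype P] (k : ℕ) : maxChainUnion P k ≤ Fintype.card P := by
  obtain ⟨C, -, hC⟩ := (maxChainUnion_isGreatest P k).1
  rw [← hC, ← Nat.card_eq_fintype_card]
  exact Set.ncard_le_card _

theorem card_le_maxChainUnion [Finite P] {T : Finset ι} (hT : T.card ≤ k) {C : ι → Set P}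
    (hC : ∀ i ∈ T, IsChain (· ≤ ·) (C i)) {U : Finset P} (hU : ∀ x ∈ U, ∃ i ∈ T, x ∈ C i) :
    U.card ≤ maxChainUnion P k := by
  let D : Fin k → Set P := fun a => {x | ∃ h : a < T.card, x ∈ C (T.equivFin.symm ⟨a, h⟩)}
  have hD : ∀ a, IsChain (· ≤ ·) (D a) := fun a x ⟨h, hx⟩ y ⟨_, hy⟩ =>
    hC _ (T.equivFin.symm ⟨a, h⟩).2 hx hy
  have hUD : (U : Set P) ⊆ ⋃ a, D a := fun x hx => by
    obtain ⟨i, hi, hxi⟩ := hU x hx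
    let a := T.equivFin ⟨i, hi⟩
    exact Set.mem_iUnion.2 ⟨⟨a, a.2.trans_le hT⟩, a.2, by simpa [a] using hxi⟩
  calc U.card = (U : Set P).ncard := (Set.ncard_coe_finset U).symm
    _ ≤ (⋃ a, D a).ncard := Set.ncard_le_ncard hUD
    _ ≤ maxChainUnion P k := (maxChainUnion_isGreatest P k).2 ⟨D, hD, rfl⟩

/-- The relation `a = r i`, `b = s i` for some `i`: the arcs of the partial map `r i ↦ s i`. -/
def IsArc (r s : κ → P) (a b : P) : Prop :=
  ∃ i, r i = a ∧ s i = b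

theorem isChain_reflTransGen_isArc {r s : κ → P} (hr : r.Injective) (hrs : ∀ i, r i ≤ s i)
    (a : P) : IsChain (· ≤ ·) {q | Relation.ReflTransGen (IsArc r s) a q} := by
  have unique : Relator.RightUnique (IsArc r s) := by
    rintro x y z ⟨i, rfl, rfl⟩ ⟨j, hj, rfl⟩
    rw [hr hj]
  have up : ∀ x y, Relation.ReflTransGen (IsArc r s) x y → x ≤ y := fun x y hxy => by
    induction hxy with
    | refl => exact le_rfl
    | tail _ harc ih =>
      obtain ⟨i, rfl, rfl⟩ := harc
      exact ih.trans (hrs i)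
  intro x hx y hy _
  exact (Relation.ReflTransGen.total_of_right_unique unique hx hy).imp (up _ _) (up _ _)

theorem exists_reflTransGen_isArc [WellFoundedLT P] {r s : κ → P} (hr : r.Injective)
    (hrs : ∀ i, r i ≤ s i) (q : P) (hq : ∀ i, s i = q → r i ≠ s i) :
    ∃ a ∉ Set.range s, Relation.ReflTransGen (IsArc r s) a q := by
  induction q using WellFoundedLT.induction with
  | ind q ih =>
    by_cases hqs : q ∈ Set.range s
    · obtain ⟨i, rfl⟩ := hqs
      have hi : r i ≠ s i := hq i rfl
      obtain ⟨a, ha, path⟩ := ih (r i) ((hrs i).lt_of_ne hi) fun j hj hloop =>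
        hi (hr (hloop.trans hj) ▸ hloop)
      exact ⟨a, ha, path.tail ⟨i, rfl, rfl⟩⟩
    · exact ⟨q, hqs, .refl⟩

/-- Every element that is not a loop is reached along arcs from an element outside `Set.range s`,
and there are at most `k` of the latter. -/
theorem card_le_card_loops_add_maxChainUnion [Fintype P] [DecidableEq P] [Fintype κ]
    {r s : κ → P} (hr : r.Injective) (hs : s.Injective) (hrs : ∀ i, r i ≤ s i)
    (hκ : Fintype.card P ≤ Fintype.card κ + k) :
    Fintype.card P ≤ (Finset.univ.filter fun i => r i = s i).card + maxChainUnion P k := by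
  let loops := (Finset.univ.filter fun i => r i = s i).image s
  let starts := (Finset.univ.image s)ᶜ
  have hstarts : starts.card ≤ k := by
    rw [Finset.card_compl, Finset.card_image_of_injective _ hs, Finset.card_univ]
    omega
  have hcover : ∀ q ∈ loopsᶜ, ∃ a ∈ starts, Relation.ReflTransGen (IsArc r s) a q := by
    intro q hq
    obtain ⟨a, ha, path⟩ :=
      exists_reflTransGen_isArc hr hrs q (by simpa [loops, imp_not_comm] using hq)
    exact ⟨a, by simpa [starts] using ha, path⟩
  have hpaths : loopsᶜ.card ≤ maxChainUnion P k :=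
    card_le_maxChainUnion hstarts (fun a _ => isChain_reflTransGen_isArc hr hrs a) hcover
  have hloops : loops.card = _ := Finset.card_image_of_injective _ hs
  rw [Finset.card_compl] at hpaths
  omega

/-- Overlaps of the `k` optimal chains are resolved arbitrarily; every element outside their union
becomes a class of its own. -/
theorem exists_chain_coloring [Finite P] (k : ℕ) :
    ∃ b : P → Fin k ⊕ P, (∀ i, IsChain (· ≤ ·) {x | b x = i}) ∧
      maxChainUnion P k ≤ ∑ i, {x | b x = .inl i}.ncard := by
  classical
  obtain ⟨C, hC, hmax⟩ := (maxChainUnion_isGreatest P k).1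
  let b : P → Fin k ⊕ P := fun x => if h : ∃ i, x ∈ C i then .inl h.choose else .inr x
  have mem_of_inl : ∀ x i, b x = .inl i → x ∈ C i := fun x i hx => by
    by_cases h : ∃ i, x ∈ C i
    · obtain rfl : h.choose = i := by simpa [b, h] using hx
      exact h.choose_spec
    · simp [b, h] at hx
  have eq_of_inr : ∀ x p, b x = .inr p → x = p := fun x p hx => by
    by_cases h : ∃ i, x ∈ C i
    · simp [b, h] at hx
    · simpa [b, h] using hx
  refine ⟨b, ?_, ?_⟩
  · rintro (i | p) x hx y hy hne
    · exact hC i (mem_of_inl x i hx) (mem_of_inl y i hy) hne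
    · exact absurd ((eq_of_inr x p hx).trans (eq_of_inr y p hy).symm) hne
  · calc maxChainUnion P k = (⋃ i, C i).ncard := hmax.symm
      _ ≤ (⋃ i, {x | b x = .inl i}).ncard := Set.ncard_le_ncard <| Set.iUnion_subset fun i x hx =>
        have h : ∃ i, x ∈ C i := ⟨i, hx⟩
        Set.mem_iUnion.2 ⟨h.choose, dif_pos h⟩
      _ ≤ ∑ i, {x | b x = .inl i}.ncard := Set.ncard_iUnion_le_of_fintype _

theorem exists_strictMono_equiv_fin_of_isChain {s : Set P} (hs : IsChain (· ≤ ·) s)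
    (hfin : s.Finite) :
    ∃ e : Fin s.ncard ≃ s, StrictMono e := by
  classical
  have := hfin.fintype
  let _ := hs.linearOrder
  let e := Fintype.orderIsoFinOfCardEq s (Set.ncard_eq_toFinset_card' s ▸ s.toFinset_card.symm)
  exact ⟨e.toEquiv, e.strictMono⟩

theorem exists_strictMono_sigma_fin_equiv [Finite P] {b : P → ι}
    (hb : ∀ i, IsChain (· ≤ ·) {x | b x = i}) :
    ∃ e : (Σ i, Fin {x | b x = i}.ncard) ≃ P, StrictMono e := by
  choose f hf using fun i =>
    exists_strictMono_equiv_fin_of_isChain (hb i) (Set.toFinite _)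
  refine ⟨(Equiv.sigmaCongrRight f).trans (Equiv.sigmaFiberEquiv b), ?_⟩
  rintro _ _ ⟨i, p, q, hpq⟩
  exact hf i hpq

end ChainUnions

section StrictIncidence

variable {P Q R S K : Type*} [PartialOrder P]

/-- `N` is a strictly upper triangular matrix with respect to the partial order of `P`, that is, a
strict element of the incidence algebra of `P` over `R`. -/
def IsStrictIncidence [Zero R] (N : Matrix P P R) : Prop :=
  ∀ ⦃i j⦄, N i j ≠ 0 → i < j

namespace IsStrictIncidence

theorem apply_eq_zero [Zero R] {N : Matrix P P R} (hN : IsStrictIncidence N) {i j : P}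
    (hij : ¬i < j) : N i j = 0 :=
  not_not.1 (mt (@hN i j) hij)

theorem reindex [Zero R] [PartialOrder Q] {N : Matrix Q Q R} (hN : IsStrictIncidence N) (e : Q ≃ P)
    (he : StrictMono e) : IsStrictIncidence (Matrix.reindex e e N) := fun i j hij => by
  simpa using he (hN hij)

theorem le_of_charmatrix_apply_ne_zero [DecidableEq P] [CommRing R] [Fintype P] {N : Matrix P P R}
    (hN : IsStrictIncidence N) {i j : P} (hij : N.charmatrix i j ≠ 0) : i ≤ j := by
  contrapose! hij
  have hne : i ≠ j := fun h => hij h.le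
  rw [charmatrix_apply_ne _ _ _ hne, hN.apply_eq_zero fun h => hij h.le, map_zero, neg_zero]

theorem X_pow_dvd_prod_charmatrix [Fintype P] [DecidableEq P] [CommRing R] {N : Matrix P P R}
    (hN : IsStrictIncidence N) {d k m : ℕ} (hd : d + maxChainUnion P k ≤ Fintype.card P)
    (hm : Fintype.card P ≤ m + k) {r s : Fin m → P} (hr : r.Injective) (hs : s.Injective) :
    X ^ d ∣ ∏ i, N.charmatrix (r i) (s i) := by
  by_cases hrs : ∀ i, r i ≤ s i
  · have hloops := card_le_card_loops_add_maxChainUnion hr hs hrs (by simpa using hm)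
    rw [← Finset.prod_filter_mul_prod_filter_not Finset.univ fun i => r i = s i]
    have hle : d ≤ (Finset.univ.filter fun i => r i = s i).card := by omega
    refine ((pow_dvd_pow X hle).trans ?_).mul_right _
    rw [← Finset.prod_const]
    refine Finset.prod_dvd_prod_of_dvd _ _ fun i hi => ?_
    rw [(Finset.mem_filter.1 hi).2, charmatrix_apply_eq, hN.apply_eq_zero (lt_irrefl _), map_zero,
      sub_zero]
  · obtain ⟨i, hi⟩ := not_forall.1 hrs
    rw [Finset.prod_eq_zero (Finset.mem_univ i)
      (not_not.1 (mt hN.le_of_charmatrix_apply_ne_zero hi))]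
    exact dvd_zero _

theorem dvdCorankMinors_charmatrix [Fintype P] [DecidableEq P] [CommRing R] {N : Matrix P P R}
    (hN : IsStrictIncidence N) {d k : ℕ} (hd : d + maxChainUnion P k ≤ Fintype.card P) :
    DvdCorankMinors (X ^ d) N.charmatrix k := fun m hm r s => by
  by_cases hr : r.Injective
  · by_cases hs : s.Injective
    · rw [det_apply']
      exact Finset.dvd_sum fun σ _ =>
        (hN.X_pow_dvd_prod_charmatrix hd hm (hr.comp σ.injective) hs).mul_left _
    · obtain ⟨i, j, hij, hne⟩ := Function.not_injective_iff.1 hs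
      rw [det_zero_of_column_eq hne fun a => by simp only [submatrix_apply, hij]]
      exact dvd_zero _
  · obtain ⟨i, j, hij, hne⟩ := Function.not_injective_iff.1 hr
    rw [det_zero_of_row_eq hne (by ext a; simp only [submatrix_apply, hij])]
    exact dvd_zero _

end IsStrictIncidence

/-- The strictly upper triangular matrix over the poset `P` whose entries at `i < j` are
independent variables. -/
noncomputable def genericStrictMatrix (P K : Type*) [PartialOrder P] [CommSemiring K] :
    Matrix P P (MvPolynomial {p : P × P // p.1 < p.2} K) := by
  classical
  exact Matrix.of fun i j => if h : i < j then .X ⟨(i, j), h⟩ else 0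

theorem IsStrictIncidence.map_aeval_genericStrictMatrix [CommSemiring K] [CommSemiring R]
    [Algebra K R] {N : Matrix P P R} (hN : IsStrictIncidence N) :
    (genericStrictMatrix P K).map (MvPolynomial.aeval fun p => N p.1.1 p.1.2) = N := by
  ext i j
  by_cases hij : i < j
  · simp [genericStrictMatrix, hij]
  · simp [genericStrictMatrix, hij, hN.apply_eq_zero hij]

theorem DvdCorankMinors.of_algebraicIndependent [Fintype P] [DecidableEq P] [CommRing K]
    [CommRing R] [Algebra K R] [CommRing S] [Algebra K S] {M : Matrix P P R} {N : Matrix P P S}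
    (hM : IsStrictIncidence M)
    (hgen : AlgebraicIndependent K fun p : {p : P × P // p.1 < p.2} => M p.1.1 p.1.2)
    (hN : IsStrictIncidence N) {d k : ℕ} (h : DvdCorankMinors (X ^ d) M.charmatrix k) :
    DvdCorankMinors (X ^ d) N.charmatrix k := by
  rw [← hM.map_aeval_genericStrictMatrix (K := K)] at h
  rw [← hN.map_aeval_genericStrictMatrix (K := K)]
  let evalM : MvPolynomial {p : P × P // p.1 < p.2} K →ₐ[K] R :=
    MvPolynomial.aeval fun p => M p.1.1 p.1.2
  let evalN : MvPolynomial {p : P × P // p.1 < p.2} K →ₐ[K] S :=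
    MvPolynomial.aeval fun p => N p.1.1 p.1.2
  exact (of_charmatrix_map (f := evalM.toRingHom) hgen h).charmatrix_map evalN.toRingHom

end StrictIncidence

section NilpotentJordan

variable {ι : Type*}

/-- The block diagonal matrix of nilpotent Jordan blocks of the given sizes. -/
def nilpotentJordan [DecidableEq ι] (size : ι → ℕ) :
    Matrix (Σ i, Fin (size i)) (Σ i, Fin (size i)) ℂ :=
  blockDiagonal' fun i => jordanBlock 0 (size i)

theorem jordanBlock_zero_apply {n : ℕ} (p q : Fin n) :
    jordanBlock 0 n p q = if (p : ℕ) + 1 = q then 1 else 0 := by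
  rw [jordanBlock, of_apply]
  rcases eq_or_ne p q with rfl | hpq
  · simp
  · rw [if_neg hpq]

theorem isStrictIncidence_nilpotentJordan [DecidableEq ι] (size : ι → ℕ) :
    IsStrictIncidence (nilpotentJordan size) := by
  rintro ⟨i, p⟩ ⟨j, q⟩ hne
  obtain rfl : i = j := by
    by_contra hij
    exact hne (blockDiagonal'_apply_ne _ _ _ hij)
  have hpq : (p : ℕ) + 1 = q := by
    by_contra hpq
    exact hne (by simp [nilpotentJordan, jordanBlock_zero_apply, hpq])
  exact Sigma.mk_lt_mk_iff.2 (Fin.lt_def.2 (by omega))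

theorem charmatrix_blockDiagonal' {R : Type*} [CommRing R] [Fintype ι] [DecidableEq ι]
    {α : ι → Type*} [∀ i, Fintype (α i)] [∀ i, DecidableEq (α i)] (A : ∀ i, Matrix (α i) (α i) R) :
    (blockDiagonal' A).charmatrix = blockDiagonal' fun i => (A i).charmatrix := by
  simp only [charmatrix, RingHom.mapMatrix_apply, scalar_apply]
  rw [← blockDiagonal'_diagonal fun _ _ => X, blockDiagonal'_map _ _ (map_zero C),
    ← blockDiagonal'_sub]
  rfl

theorem det_blockDiagonal'_eq_prod {R : Type*} [CommRing R] [Fintype ι] [DecidableEq ι]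
    {α : ι → Type*} [∀ i, Fintype (α i)] [∀ i, DecidableEq (α i)] (A : ∀ i, Matrix (α i) (α i) R) :
    (blockDiagonal' A).det = ∏ i, (A i).det := by
  let _ : LinearOrder ι := LinearOrder.lift' (Fintype.equivFin ι) (Fintype.equivFin ι).injective
  rw [(blockTriangular_blockDiagonal' A).det_fintype]
  refine Finset.prod_congr rfl fun i _ => ?_
  rw [← det_submatrix_equiv_self (Equiv.sigmaSubtype i).symm]
  congr 1
  ext x y
  exact blockDiagonal'_apply_eq A i x y

theorem submatrix_sigmaMap_blockDiagonal' {R : Type*} [Zero R] [DecidableEq ι]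
    {α β γ δ : ι → Type*} (A : ∀ i, Matrix (γ i) (δ i) R) (r : ∀ i, α i → γ i)
    (s : ∀ i, β i → δ i) :
    (blockDiagonal' A).submatrix (Sigma.map id r) (Sigma.map id s) =
      blockDiagonal' fun i => (A i).submatrix (r i) (s i) := by
  ext ⟨i, p⟩ ⟨j, q⟩
  obtain rfl | hij := eq_or_ne i j
  · simp [Sigma.map]
  · simp [Sigma.map, blockDiagonal'_apply_ne _ _ _ hij]

theorem charmatrix_jordanBlock_zero_apply {n : ℕ} (p q : Fin n) :
    (jordanBlock 0 n).charmatrix p q =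
      if p = q then X else if (p : ℕ) + 1 = q then -1 else 0 := by
  rcases eq_or_ne p q with rfl | hpq
  · simp [jordanBlock_zero_apply]
  · rw [charmatrix_apply_ne _ _ _ hpq, jordanBlock_zero_apply, if_neg hpq]
    split_ifs <;> simp

theorem det_charmatrix_jordanBlock_zero (n : ℕ) : (jordanBlock 0 n).charmatrix.det = X ^ n := by
  have upper : (jordanBlock 0 n).charmatrix.IsUpperTriangular := fun p q (hqp : q < p) => by
    rw [charmatrix_jordanBlock_zero_apply, if_neg hqp.ne', if_neg]
    omega
  simp only [det_of_isUpperTriangular upper, charmatrix_jordanBlock_zero_apply, if_true,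
    Finset.prod_const, Finset.card_univ, Fintype.card_fin]

theorem exists_isUnit_det_charmatrix_jordanBlock_zero (n : ℕ) :
    ∃ (m : ℕ) (r s : Fin m → Fin n), n ≤ m + 1 ∧
      IsUnit ((jordanBlock 0 n).charmatrix.submatrix r s).det := by
  obtain _ | n := n
  · exact ⟨0, Fin.elim0, Fin.elim0, Nat.zero_le _, by simp⟩
  refine ⟨n, Fin.castSucc, Fin.succ, le_rfl, ?_⟩
  have lower : ((jordanBlock 0 (n + 1)).charmatrix.submatrix
      Fin.castSucc Fin.succ).IsLowerTriangular := fun p q (hpq : p < q) => by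
    rw [submatrix_apply, charmatrix_jordanBlock_zero_apply, if_neg, if_neg]
    all_goals simp only [Fin.ext_iff, Fin.val_castSucc, Fin.val_succ]; omega
  have diagonal (p : Fin n) :
      (jordanBlock 0 (n + 1)).charmatrix.submatrix Fin.castSucc Fin.succ p p = -1 := by
    rw [submatrix_apply, charmatrix_jordanBlock_zero_apply]
    simp [Fin.ext_iff]
  rw [det_of_isLowerTriangular _ lower, Finset.prod_congr rfl fun p _ => diagonal p,
    Finset.prod_const]
  exact isUnit_one.neg.pow _

theorem exists_associated_det_charmatrix_jordanBlock_zero (n : ℕ) (c : Prop) [Decidable c] :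
    ∃ (m : ℕ) (r s : Fin m → Fin n), n ≤ m + (if c then 1 else 0) ∧
      Associated ((jordanBlock 0 n).charmatrix.submatrix r s).det (X ^ if c then 0 else n) := by
  by_cases hc : c
  · obtain ⟨m, r, s, hm, hunit⟩ := exists_isUnit_det_charmatrix_jordanBlock_zero n
    exact ⟨m, r, s, by simpa [hc] using hm, by simpa [hc, associated_one_iff_isUnit] using hunit⟩
  · refine ⟨n, id, id, by simp, ?_⟩
    simp [hc, det_charmatrix_jordanBlock_zero]

theorem add_sum_le_of_dvdCorankMinors_nilpotentJordan [Fintype ι] [DecidableEq ι] {size : ι → ℕ}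
    {d k : ℕ} (h : DvdCorankMinors (X ^ d) (nilpotentJordan size).charmatrix k) {T : Finset ι}
    (hT : T.card ≤ k) : d + ∑ i ∈ T, size i ≤ ∑ i, size i := by
  choose m r s hm hdet using fun i =>
    exists_associated_det_charmatrix_jordanBlock_zero (size i) (i ∈ T)
  have hcorank : ∑ i, size i ≤ ∑ i, m i + k := calc
    ∑ i, size i ≤ ∑ i, (m i + if i ∈ T then 1 else 0) := Finset.sum_le_sum fun i _ => hm i
    _ = ∑ i, m i + T.card := by simp [Finset.sum_add_distrib]
    _ ≤ ∑ i, m i + k := by gcongr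
  have hblocks : ((nilpotentJordan size).charmatrix.submatrix
      (Sigma.map id r) (Sigma.map id s)).det =
        ∏ i, ((jordanBlock 0 (size i)).charmatrix.submatrix (r i) (s i)).det := by
    rw [← det_blockDiagonal'_eq_prod, nilpotentJordan, charmatrix_blockDiagonal',
      submatrix_sigmaMap_blockDiagonal']
  have hminor : Associated (∏ i, ((jordanBlock 0 (size i)).charmatrix.submatrix (r i) (s i)).det)
      (X ^ ∑ i ∈ Tᶜ, size i) := by
    have hexp : ∑ i ∈ Tᶜ, size i = ∑ i, if i ∈ T then 0 else size i := by
      simp [Finset.sum_ite, Finset.filter_not, Finset.compl_eq_univ_sdiff]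
    rw [hexp, ← Finset.prod_pow_eq_pow_sum]
    exact Associated.prod _ _ _ fun i _ => hdet i
  have hdvd : (X : ℂ[X]) ^ d ∣ X ^ ∑ i ∈ Tᶜ, size i := by
    rw [← hminor.dvd_iff_dvd_right, ← hblocks]
    exact h.dvd_det_submatrix (by simpa using hcorank) _ _
  rw [← Finset.sum_compl_add_sum T]
  gcongr
  exact (pow_dvd_pow_iff X_ne_zero not_isUnit_X).1 hdvd

end NilpotentJordan

section DisjointUnion

variable {ι : Type*} {α : ι → Type*} {k : ℕ}

theorem exists_card_le_one_of_isChain_sigma [∀ i, LE (α i)] {s : Set (Σ i, α i)}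
    (hs : IsChain (· ≤ ·) s) : ∃ t : Finset ι, t.card ≤ 1 ∧ ∀ x ∈ s, x.1 ∈ t := by
  obtain rfl | ⟨x, hx⟩ := s.eq_empty_or_nonempty
  · exact ⟨∅, by simp⟩
  have fst_eq_of_le : ∀ y z : Σ i, α i, y ≤ z → y.1 = z.1 := by
    rintro _ _ ⟨⟩
    rfl
  refine ⟨{x.1}, by simp, fun y hy => Finset.mem_singleton.2 ?_⟩
  by_contra hne
  rcases hs hx hy fun h => hne (h ▸ rfl) with h | h
  · exact hne (fst_eq_of_le _ _ h).symm
  · exact hne (fst_eq_of_le _ _ h)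

theorem exists_maxChainUnion_sigma_le_sum [Finite ι] [∀ i, PartialOrder (α i)]
    [∀ i, Fintype (α i)] (k : ℕ) : ∃ T : Finset ι, T.card ≤ k ∧
      maxChainUnion (Σ i, α i) k ≤ ∑ i ∈ T, Fintype.card (α i) := by
  classical
  obtain ⟨C, hC, hmax⟩ := (maxChainUnion_isGreatest (Σ i, α i) k).1
  choose t ht hCt using fun a => exists_card_le_one_of_isChain_sigma (hC a)
  let T := Finset.univ.biUnion t
  refine ⟨T, by simpa using Finset.card_biUnion_le_card_mul Finset.univ t 1 fun a _ => ht a, ?_⟩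
  have hsub : (⋃ a, C a) ⊆ (T.sigma fun _ => Finset.univ : Finset (Σ i, α i)) :=
    Set.iUnion_subset fun a x hx => by
      simpa [T] using ⟨a, hCt a x hx⟩
  calc maxChainUnion (Σ i, α i) k = (⋃ a, C a).ncard := hmax.symm
    _ ≤ ((T.sigma fun _ => Finset.univ : Finset (Σ i, α i)) : Set (Σ i, α i)).ncard :=
      Set.ncard_le_ncard hsub
    _ = ∑ i ∈ T, Fintype.card (α i) := by
      simp only [Set.ncard_coe_finset, Finset.card_sigma, Finset.card_univ]

theorem sum_card_le_maxChainUnion_sigma [Finite ι] [∀ i, LinearOrder (α i)]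
    [∀ i, Fintype (α i)] {T : Finset ι} (hT : T.card ≤ k) :
    ∑ i ∈ T, Fintype.card (α i) ≤ maxChainUnion (Σ i, α i) k := by
  have hblock : ∀ i, IsChain (· ≤ ·) {x : Σ i, α i | x.1 = i} := by
    rintro i ⟨_, p⟩ rfl ⟨_, q⟩ rfl _
    exact (le_total p q).imp Sigma.mk_le_mk_iff.2 Sigma.mk_le_mk_iff.2
  have hU : ∀ x ∈ T.sigma fun i => (Finset.univ : Finset (α i)), ∃ i ∈ T, x ∈ {x | x.1 = i} :=
    fun x hx => ⟨x.1, (Finset.mem_sigma.1 hx).1, rfl⟩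
  simpa using card_le_maxChainUnion hT (fun i _ => hblock i) hU

end DisjointUnion

section CorankMinors

variable {P R ι : Type*} [Fintype P] [DecidableEq P] [PartialOrder P] {d k : ℕ}

theorem dvdCorankMinors_nilpotentJordan_iff [Fintype ι] [DecidableEq ι] {size : ι → ℕ} :
    DvdCorankMinors (X ^ d) (nilpotentJordan size).charmatrix k ↔
      d + maxChainUnion (Σ i, Fin (size i)) k ≤ Fintype.card (Σ i, Fin (size i)) := by
  refine ⟨fun h => ?_, (isStrictIncidence_nilpotentJordan size).dvdCorankMinors_charmatrix⟩
  obtain ⟨T, hT, hle⟩ := exists_maxChainUnion_sigma_le_sum (α := fun i => Fin (size i)) k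
  simp only [Fintype.card_fin, Fintype.card_sigma] at hle ⊢
  have := add_sum_le_of_dvdCorankMinors_nilpotentJordan h hT
  omega

/-- Every strictly upper triangular matrix specializes the generic one. The specialization that
witnesses optimality is the nilpotent Jordan matrix of `k` chains with a maximal union. -/
theorem dvdCorankMinors_charmatrix_iff_of_algebraicIndependent [CommRing R] [Algebra ℚ R]
    {M : Matrix P P R} (hM : IsStrictIncidence M)
    (hgen : AlgebraicIndependent ℚ fun p : {p : P × P // p.1 < p.2} => M p.1.1 p.1.2) :
    DvdCorankMinors (X ^ d) M.charmatrix k ↔ d + maxChainUnion P k ≤ Fintype.card P := by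
  refine ⟨fun h => ?_, hM.dvdCorankMinors_charmatrix⟩
  obtain ⟨b, hb, hmax⟩ := exists_chain_coloring (P := P) k
  obtain ⟨e, he⟩ := exists_strictMono_sigma_fin_equiv hb
  have hN := (isStrictIncidence_nilpotentJordan _).reindex e he
  have hJordan := add_sum_le_of_dvdCorankMinors_nilpotentJordan
    ((dvdCorankMinors_charmatrix_reindex_iff e).1 (h.of_algebraicIndependent hM hgen hN))
    (T := Finset.univ.map .inl) (by simp)
  have hcard : ∑ i, {x | b x = i}.ncard = Fintype.card P := by
    simpa using Fintype.card_congr e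
  rw [Finset.sum_map, hcard] at hJordan
  exact (Nat.add_le_add_left hmax d).trans hJordan

theorem maxChainUnion_eq_of_eq_conj_nilpotentJordan [Finite ι] [DecidableEq ι]
    {M : Matrix P P ℂ} (hM : IsStrictIncidence M)
    (hgen : AlgebraicIndependent ℚ fun p : {p : P × P // p.1 < p.2} => M p.1.1 p.1.2)
    {size : ι → ℕ} (e : (Σ i, Fin (size i)) ≃ P) (S : (Matrix P P ℂ)ˣ)
    (hconj : M = S.val * reindex e e (nilpotentJordan size) * S⁻¹.val) (k : ℕ) :
    maxChainUnion P k = maxChainUnion (Σ i, Fin (size i)) k := by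
  have := Fintype.ofFinite ι
  have hiff (d : ℕ) : d + maxChainUnion P k ≤ Fintype.card P ↔
      d + maxChainUnion (Σ i, Fin (size i)) k ≤ Fintype.card P := by
    rw [← dvdCorankMinors_charmatrix_iff_of_algebraicIndependent hM hgen, hconj,
      dvdCorankMinors_charmatrix_units_conj_iff, dvdCorankMinors_charmatrix_reindex_iff,
      dvdCorankMinors_nilpotentJordan_iff, Fintype.card_congr e]
  have hP := maxChainUnion_le_card (P := P) k
  have hQ := maxChainUnion_le_card (P := Σ i, Fin (size i)) k
  rw [Fintype.card_congr e] at hQ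
  have := hiff (Fintype.card P - maxChainUnion P k)
  have := hiff (Fintype.card P - maxChainUnion (Σ i, Fin (size i)) k)
  omega

end CorankMinors

section ChainShape

variable {r k : ℕ} {size : Fin r → ℕ}

theorem sum_le_sum_filter_val_lt_of_antitone (hsize : Antitone size) {T : Finset (Fin r)}
    (hT : T.card ≤ k) : ∑ i ∈ T, size i ≤ ∑ i with i.val < k, size i := by
  obtain hrk | hkr := le_or_gt r k
  · refine Finset.sum_le_sum_of_subset fun i _ => ?_
    simpa using i.2.trans_le hrk
  let L := Finset.univ.filter fun i : Fin r => i.val < k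
  have hcard : (T \ L).card ≤ (L \ T).card := by
    rw [Finset.card_sdiff_le_card_sdiff_iff, Fin.card_filter_val_lt, min_eq_right hkr.le]
    exact hT
  have hexchange : ∑ i ∈ T \ L, size i ≤ ∑ i ∈ L \ T, size i := calc
    ∑ i ∈ T \ L, size i ≤ (T \ L).card • size ⟨k, hkr⟩ :=
      Finset.sum_le_card_nsmul _ _ _ fun i hi =>
        hsize (by simpa [L, Fin.le_def] using (Finset.mem_sdiff.1 hi).2)
    _ ≤ (L \ T).card • size ⟨k, hkr⟩ := by gcongr
    _ ≤ ∑ i ∈ L \ T, size i :=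
      Finset.card_nsmul_le_sum _ _ _ fun i hi =>
        hsize (Finset.mem_filter.1 (Finset.mem_sdiff.1 hi).1).2.le
  exact Finset.sum_sdiff_le_sum_sdiff.1 hexchange

theorem maxChainUnion_sigma_fin_of_antitone (hsize : Antitone size) (k : ℕ) :
    maxChainUnion (Σ i, Fin (size i)) k = ∑ i with i.val < k, size i := by
  obtain ⟨T, hT, hle⟩ := exists_maxChainUnion_sigma_le_sum (α := fun i => Fin (size i)) k
  have hcard : (Finset.univ.filter fun i : Fin r => i.val < k).card ≤ k := by
    simp [Fin.card_filter_val_lt]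
  have hge := sum_card_le_maxChainUnion_sigma (α := fun i => Fin (size i)) hcard
  simp only [Fintype.card_fin] at hle hge
  exact (hle.trans (sum_le_sum_filter_val_lt_of_antitone hsize hT)).antisymm hge

theorem chainShape_sigma_fin_of_antitone (hsize : Antitone size) (k : ℕ) :
    chainShape (Σ i, Fin (size i)) k = if h : k < r then size ⟨k, h⟩ else 0 := by
  rw [chainShape, maxChainUnion_sigma_fin_of_antitone hsize,
    maxChainUnion_sigma_fin_of_antitone hsize]
  split_ifs with hk
  · have hinsert : (Finset.univ.filter fun i : Fin r => i.val < k + 1) =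
        insert ⟨k, hk⟩ (Finset.univ.filter fun i : Fin r => i.val < k) := by
      ext i
      grind
    rw [hinsert, Finset.sum_insert (by simp), Nat.add_sub_cancel]
  · have hfilter : (Finset.univ.filter fun i : Fin r => i.val < k + 1) =
        Finset.univ.filter fun i : Fin r => i.val < k := by
      ext i
      grind
    rw [hfilter, Nat.sub_self]

end ChainShape

section NilpotentIncidence

variable {P : Type*} [PartialOrder P] [Fintype P] [DecidableEq P] {M : Matrix P P ℂ}

theorem pow_apply_self_of_mem_incidenceMatrixAlgebra (hM : M ∈ incidenceMatrixAlgebra P) (a : ℕ)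
    (i : P) : (M ^ a) i i = M i i ^ a := by
  induction a with
  | zero => simp
  | succ a ih =>
    rw [pow_succ, pow_succ, ← ih, mul_apply]
    refine Finset.sum_eq_single i (fun l _ hl => ?_) (by simp)
    by_contra hne
    have hil : i ≤ l := (incidenceMatrixAlgebra P).pow_mem hM a i l (left_ne_zero_of_mul hne)
    exact hl ((hM l i (right_ne_zero_of_mul hne)).antisymm hil)

theorem isStrictIncidence_of_isNilpotent (hM : M ∈ incidenceMatrixAlgebra P)
    (hnil : IsNilpotent M) : IsStrictIncidence M := fun i j hij => by
  refine (hM i j hij).lt_of_ne ?_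
  rintro rfl
  obtain ⟨a, ha⟩ := hnil
  refine hij (eq_zero_of_pow_eq_zero (n := a) ?_)
  rw [← pow_apply_self_of_mem_incidenceMatrixAlgebra hM, ha, Matrix.zero_apply]

theorem blockDiagonal'_jordanBlock_mem_incidenceMatrixAlgebra {ι : Type*} [Fintype ι]
    [DecidableEq ι] (eig : ι → ℂ) (size : ι → ℕ) :
    blockDiagonal' (fun i => jordanBlock (eig i) (size i)) ∈
      incidenceMatrixAlgebra (Σ i, Fin (size i)) := by
  rintro ⟨i, p⟩ ⟨j, q⟩ hne
  obtain rfl : i = j := by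
    by_contra hij
    exact hne (blockDiagonal'_apply_ne _ _ _ hij)
  rw [blockDiagonal'_apply_eq] at hne
  refine Sigma.mk_le_mk_iff.2 (le_of_not_gt fun hqp => hne ?_)
  simp only [jordanBlock, of_apply, if_neg hqp.ne', ite_eq_right_iff]
  omega

theorem eigenvalue_eq_zero_of_isNilpotent_blockDiagonal' {ι : Type*} [Fintype ι] [DecidableEq ι]
    {eig : ι → ℂ} {size : ι → ℕ} (hpos : ∀ i, 0 < size i)
    (hnil : IsNilpotent (blockDiagonal' fun i => jordanBlock (eig i) (size i))) : eig = 0 := by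
  funext i
  have hdiag := (isStrictIncidence_of_isNilpotent
    (blockDiagonal'_jordanBlock_mem_incidenceMatrixAlgebra eig size) hnil).apply_eq_zero
      (lt_irrefl (⟨i, ⟨0, hpos i⟩⟩ : Σ i, Fin (size i)))
  simpa [jordanBlock] using hdiag

end NilpotentIncidence

section JordanForm

variable {K V P ι : Type*} [Field K]

theorem exists_basis_quotient_X_pow {R : Type*} [CommRing R] [Nontrivial R] (m : ℕ) :
    ∃ b : Module.Basis (Fin m) R (R[X] ⧸ R[X] ∙ (X : R[X]) ^ m),
      ∀ j, b j = Submodule.Quotient.mk (X ^ (j : ℕ)) := by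
  let B := AdjoinRoot.powerBasis' (monic_X_pow (R := R) m)
  have hdim : B.dim = m := by simp [B, AdjoinRoot.powerBasis'_dim]
  let b : Module.Basis (Fin m) R (AdjoinRoot (X ^ m : R[X])) := B.basis.reindex (finCongr hdim)
  have hb (j) : b j = AdjoinRoot.mk (X ^ m) (X ^ (j : ℕ)) := by
    simp [b, B, AdjoinRoot.powerBasis'_gen]
  exact ⟨b, hb⟩

theorem dfinsupp_basis_apply {R : Type*} [Semiring R] [DecidableEq ι] {η : ι → Type*}
    {N : ι → Type*} [∀ i, AddCommMonoid (N i)] [∀ i, Module R (N i)]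
    (b : ∀ i, Module.Basis (η i) R (N i)) (i : ι) (j : η i) :
    DFinsupp.basis b ⟨i, j⟩ = DFinsupp.single i (b i j) := by
  refine (DFinsupp.basis b).repr.injective ?_
  rw [Module.Basis.repr_self]
  ext ⟨i', j'⟩
  change _ = (b i').repr (DFinsupp.single i (b i j) i') j'
  obtain rfl | hne := eq_or_ne i i'
  · classical simp [Finsupp.single_apply]
  · simp [hne, hne.symm]

theorem exists_basis_jordan_chains [AddCommGroup V] [Module K V] [Module.Finite K V]
    {φ : Module.End K V} (hφ : IsNilpotent φ) :
    ∃ (d : ℕ) (m : Fin d → ℕ) (b : Module.Basis (Σ i, Fin (m i)) K V),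
      ∀ i (j : Fin (m i)), φ (b ⟨i, j⟩) =
        if h : (j : ℕ) + 1 < m i then b ⟨i, ⟨j + 1, h⟩⟩ else 0 := by
  have htors : Module.IsTorsion' (Module.AEval' φ) (Submonoid.powers (X : K[X])) := by
    obtain ⟨a, ha⟩ := hφ
    refine (Submodule.isTorsion'_powers_iff _).2 fun x => ⟨a, ?_⟩
    apply (Module.AEval'.of φ).symm.injective
    rw [Module.AEval.of_symm_smul, aeval_X_pow, ha, zero_smul, map_zero]
  obtain ⟨d, m, ⟨e⟩⟩ := Module.torsion_by_prime_power_decomposition irreducible_X htors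
  choose c hc using exists_basis_quotient_X_pow (R := K)
  let B : Module.Basis (Σ i, Fin (m i)) K (DirectSum (Fin d) fun i => K[X] ⧸ K[X] ∙ X ^ m i) :=
    DFinsupp.basis fun i => c (m i)
  have hB (i) (j : Fin (m i)) : B ⟨i, j⟩ = DirectSum.lof K[X] (Fin d)
      (fun i => K[X] ⧸ K[X] ∙ X ^ m i) i (Submodule.Quotient.mk (X ^ (j : ℕ))) := by
    rw [← hc]
    exact dfinsupp_basis_apply (fun i => c (m i)) i j
  let f := (e.restrictScalars K).symm.trans (Module.AEval'.of φ).symm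
  have hf (y) : φ (f y) = f ((X : K[X]) • y) := by
    change φ ((Module.AEval'.of φ).symm (e.symm y)) = (Module.AEval'.of φ).symm (e.symm (X • y))
    rw [map_smul, Module.AEval'.of_symm_X_smul]
  refine ⟨d, m, B.map f, fun i j => ?_⟩
  rw [Module.Basis.map_apply, hf, hB, ← map_smul, ← Submodule.Quotient.mk_smul, smul_eq_mul,
    ← pow_succ']
  split_ifs with h
  · rw [Module.Basis.map_apply, hB]
  · have hj : (j : ℕ) + 1 = m i := by omega
    rw [hj, (Submodule.Quotient.mk_eq_zero _).2 (Submodule.mem_span_singleton_self _), map_zero,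
      map_zero]

theorem exists_toMatrix_eq_transpose_nilpotentJordan [AddCommGroup V] [Module ℂ V]
    [Module.Finite ℂ V] {φ : Module.End ℂ V} (hφ : IsNilpotent φ) :
    ∃ (d : ℕ) (m : Fin d → ℕ) (b : Module.Basis (Σ i, Fin (m i)) ℂ V),
      LinearMap.toMatrix b b φ = (nilpotentJordan m)ᵀ := by
  obtain ⟨d, m, b, hb⟩ := exists_basis_jordan_chains hφ
  refine ⟨d, m, b, ?_⟩
  ext ⟨i, p⟩ ⟨j, q⟩
  rw [LinearMap.toMatrix_apply, hb, transpose_apply]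
  obtain rfl | hij := eq_or_ne j i
  · rw [nilpotentJordan, blockDiagonal'_apply_eq, jordanBlock_zero_apply]
    split_ifs with hq hqp hqp
    · simp [hqp]
    · simp [Fin.ext_iff, hqp]
    · exact absurd (hqp ▸ p.2) hq
    · simp
  · rw [nilpotentJordan, blockDiagonal'_apply_ne _ _ _ hij]
    split_ifs <;> simp [hij]

theorem exists_eq_conj_nilpotentJordan [Fintype P] [DecidableEq P] {M : Matrix P P ℂ}
    (hM : IsNilpotent M) :
    ∃ (d : ℕ) (m : Fin d → ℕ) (e : (Σ i, Fin (m i)) ≃ P) (S : (Matrix P P ℂ)ˣ),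
      M = S.val * reindex e e (nilpotentJordan m) * S⁻¹.val := by
  have hφ : IsNilpotent (toLin' Mᵀ) := (isNilpotent_toLin'_iff _).2 (isNilpotent_transpose_iff.2 hM)
  obtain ⟨d, m, b, hb⟩ := exists_toMatrix_eq_transpose_nilpotentJordan hφ
  let std := Pi.basisFun ℂ P
  let e := b.indexEquiv std
  let c := b.reindex e
  let S : (Matrix P P ℂ)ˣ := ⟨(c.toMatrix std)ᵀ, (std.toMatrix c)ᵀ,
    by rw [← transpose_mul, std.toMatrix_mul_toMatrix_flip, transpose_one],
    by rw [← transpose_mul, c.toMatrix_mul_toMatrix_flip, transpose_one]⟩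
  have hc : LinearMap.toMatrix c c (toLin' Mᵀ) = (reindex e e (nilpotentJordan m))ᵀ := by
    rw [transpose_reindex, ← hb]
    ext p q
    simp [c, LinearMap.toMatrix_apply]
  refine ⟨d, m, e, S, transpose_injective ?_⟩
  have hS : (S.val * reindex e e (nilpotentJordan m) * S⁻¹.val)ᵀ =
      std.toMatrix c * LinearMap.toMatrix c c (toLin' Mᵀ) * c.toMatrix std := by
    rw [hc, transpose_mul, transpose_mul, mul_assoc]
    rfl
  rw [hS, basis_toMatrix_mul_linearMap_toMatrix_mul_basis_toMatrix]
  exact (LinearMap.toMatrix'_toLin' _).symm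

theorem exists_nilpotentJordan_eq_reindex_antitone [Finite ι] [DecidableEq ι] (m : ι → ℕ) :
    ∃ (r : ℕ) (size : Fin r → ℕ) (τ : (Σ a, Fin (size a)) ≃ Σ i, Fin (m i)),
      (∀ a, 0 < size a) ∧ Antitone size ∧
        nilpotentJordan m = reindex τ τ (nilpotentJordan size) := by
  have := Fintype.ofFinite ι
  let ρ₀ := (Fintype.equivFin {i : ι // 0 < m i}).symm
  let ρ := (Tuple.sort fun a => OrderDual.toDual (m (ρ₀ a))).trans ρ₀
  let τ : (Σ a, Fin (m (ρ a))) ≃ Σ i, Fin (m i) :=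
    (Equiv.sigmaCongrLeft (β := fun i : {i // 0 < m i} => Fin (m i)) ρ).trans
      (Equiv.sigmaSubtypeEquivOfSubset (fun i => Fin (m i)) _ fun _ p => Fin.pos p)
  refine ⟨_, fun a => m (ρ a), τ, fun a => (ρ a).2,
    Tuple.monotone_sort fun a => OrderDual.toDual (m (ρ₀ a)), ?_⟩
  ext x y
  obtain ⟨⟨a, p⟩, rfl⟩ := τ.surjective x
  obtain ⟨⟨b, q⟩, rfl⟩ := τ.surjective y
  simp only [reindex_apply, submatrix_apply, Equiv.symm_apply_apply]
  obtain rfl | hab := eq_or_ne a b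
  · rw [nilpotentJordan, nilpotentJordan, blockDiagonal'_apply_eq]
    exact blockDiagonal'_apply_eq (fun i => jordanBlock 0 (m i)) (ρ a) p q
  · rw [nilpotentJordan, nilpotentJordan, blockDiagonal'_apply_ne _ _ _ hab]
    exact blockDiagonal'_apply_ne _ _ _ fun h => hab (ρ.injective (Subtype.ext h))

theorem exists_isJordanPartition_of_isNilpotent [Fintype P] [DecidableEq P] {M : Matrix P P ℂ}
    (hM : IsNilpotent M) : ∃ ν, IsJordanPartition M ν := by
  obtain ⟨d, m, e, S, hconj⟩ := exists_eq_conj_nilpotentJordan hM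
  obtain ⟨r, size, τ, hpos, hanti, hτ⟩ := exists_nilpotentJordan_eq_reindex_antitone m
  refine ⟨_, r, size, 0, τ.trans e, S, hpos, hanti, ?_, fun _ => rfl⟩
  rw [hconj, hτ]
  rfl

end JordanForm

theorem IsJordanPartition.exists_nilpotentJordan {P : Type*} [Fintype P] [DecidableEq P]
    {M : Matrix P P ℂ} (hnil : IsNilpotent M) {ν : ℕ → ℕ} (hν : IsJordanPartition M ν) :
    ∃ (r : ℕ) (size : Fin r → ℕ) (e : (Σ i, Fin (size i)) ≃ P) (S : (Matrix P P ℂ)ˣ),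
      Antitone size ∧ M = S.val * reindex e e (nilpotentJordan size) * S⁻¹.val ∧
        ∀ k, ν k = if h : k < r then size ⟨k, h⟩ else 0 := by
  obtain ⟨r, size, eig, e, S, hpos, hanti, hconj, hsize⟩ := hν
  obtain rfl : eig = 0 := by
    refine eigenvalue_eq_zero_of_isNilpotent_blockDiagonal' hpos ?_
    obtain ⟨a, ha⟩ := hnil
    rw [hconj, Units.conj_pow, Units.mul_left_eq_zero, Units.mul_right_eq_zero] at ha
    exact (IsNilpotent.map_iff (reindexAlgEquiv ℂ ℂ e).injective).1 ⟨a, ha⟩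
  exact ⟨r, size, e, S, hanti, hconj, hsize⟩

theorem IsJordanPartition.eq_chainShape {P : Type*} [PartialOrder P] [Fintype P] [DecidableEq P]
    {M : Matrix P P ℂ} (hM : IsGenericNilpotent M) {ν : ℕ → ℕ} (hν : IsJordanPartition M ν) :
    ν = chainShape P := by
  obtain ⟨r, size, e, S, hanti, hconj, hsize⟩ := hν.exists_nilpotentJordan hM.nilpotent
  have hstrict := isStrictIncidence_of_isNilpotent hM.mem hM.nilpotent
  have hmax := maxChainUnion_eq_of_eq_conj_nilpotentJordan hstrict hM.generic e S hconj
  funext k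
  rw [hsize, chainShape, hmax, hmax, ← chainShape, chainShape_sigma_fin_of_antitone hanti]

theorem theorem6p1 {P : Type*} [PartialOrder P] [Fintype P] [DecidableEq P]
    (M : Matrix P P ℂ) (hM : IsGenericNilpotent M) (ν : ℕ → ℕ) :
    IsJordanPartition M ν ↔ ν = chainShape P := by
  refine ⟨fun hν => hν.eq_chainShape hM, ?_⟩
  rintro rfl
  obtain ⟨ν, hν⟩ := exists_isJordanPartition_of_isNilpotent hM.nilpotent
  exact hν.eq_chainShape hM ▸ hν
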